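/- Let $\mathcal H$ be a complex Hilbert space and let $A,B\in\mathcal B(\mathcal H)$ be bounded linear operators on $\mathcal H$. For $T\in\mathcal B(\mathcal H)$ let $T^*$ be its adjoint, $|T|=(T^*T)^{1/2}$, let $\|T\|$ be the operator norm and let $w(T)=\sup\{|\langle Tx,x\rangle| : x\in\mathcal H,\ \|x\|=1\}$ be the numerical radius (with $w(T)=0$ if $\mathcal H=\{0\}$). Real powers of $|T|$ are taken by the continuous functional calculus, with $|T|^0=I$. Then, for each of the two choices of the sign, $$w(AB\pm BA)\le \frac14\Big(\inf_{t\in[0,1]}\big\||A|^{2t}+|B^*|^{2t}\big\|\,\big\||A^*|^{2(1-t)}+|B|^{2(1-t)}\big\| \;+\; \inf_{t\in[0,1]}\big\||B|^{2t}+|A^*|^{2t}\big\|\,\big\||B^*|^{2(1-t)}+|A|^{2(1-t)}\big\|\Big).$$ -/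

import Mathlib

/-- The numerical radius `w(T) = sup {|⟨T x, x⟩| : ‖x‖ = 1}` of a bounded operator on a complex
Hilbert space. The set is bounded above by `‖T‖`; it is empty only on the zero space, where
the supremum is `0`. -/
noncomputable def numericalRadius {H : Type*} [NormedAddCommGroup H] [InnerProductSpace ℂ H]
    (T : H →L[ℂ] H) : ℝ :=
  sSup {r : ℝ | ∃ x : H, ‖x‖ = 1 ∧ r = ‖inner ℂ (T x) x‖}

open Filter Topology Polynomial

section Intertwining

variable {𝒜 : Type*} [CStarAlgebra 𝒜]

/-! The triangle inequality reduces the claim to bounding |⟨ABx,x⟩| = |⟨A⋆x,Bx⟩|, then swapping A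
and B. Polar decomposition suggests Bx = |B⋆|ᵗv and A⋆x = |A|ᵗu with ‖v‖ ≤ ‖|B|¹⁻ᵗx‖ and ‖u‖ ≤
‖|A⋆|¹⁻ᵗx‖; here this holds along sequences. Operator AM-GM for |A|ᵗ, |B⋆|ᵗ and scalar AM-GM for
‖u‖‖v‖ each give a factor 1/2. -/

theorem SemiconjBy.aeval_right {a x y : 𝒜} (h : SemiconjBy a x y) (p : ℝ[X]) :
    SemiconjBy a (aeval x p) (aeval y p) := by
  induction p using Polynomial.induction_on' with
  | add p q hp hq => simpa only [map_add] using hp.add_right hq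
  | monomial n r =>
    simp only [aeval_monomial]
    exact SemiconjBy.mul_right (Algebra.commutes r a).symm (h.pow_right n)

/-- The real continuous functional calculus respects intertwining relations between
self-adjoint elements. -/
theorem SemiconjBy.cfc_real {a x y : 𝒜} (h : SemiconjBy a x y) (hx : IsSelfAdjoint x)
    (hy : IsSelfAdjoint y) {f : ℝ → ℝ} (hf : Continuous f) :
    SemiconjBy a (cfc f x) (cfc f y) := by
  -- Both spectra lie in [-R, R], so a single polynomial approximates f on both.
  set R : ℝ := max (‖x‖ * ‖(1 : 𝒜)‖) (‖y‖ * ‖(1 : 𝒜)‖) with hR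
  have key : ∀ ε > 0, ‖a * cfc f x - cfc f y * a‖ ≤ 2 * ‖a‖ * ε := by
    intro ε hε
    obtain ⟨p, hp⟩ := exists_polynomial_near_of_continuousOn (-R) R f hf.continuousOn ε hε
    have near : ∀ z : 𝒜, IsSelfAdjoint z → ‖z‖ * ‖(1 : 𝒜)‖ ≤ R →
        ‖cfc f z - aeval z p‖ ≤ ε := by
      intro z hz hzR
      rw [← cfc_polynomial p z hz, ← cfc_sub f p.eval z]
      refine norm_cfc_le hε.le fun s hs => ?_
      have hs' : |s| ≤ R := (spectrum.norm_le_norm_mul_of_mem hs).trans hzR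
      rw [Real.norm_eq_abs, abs_sub_comm]
      exact (hp s (abs_le.mp hs')).le
    have hpx := near x hx (le_max_left _ _)
    have hpy := near y hy (le_max_right _ _)
    have e : a * cfc f x - cfc f y * a
        = a * (cfc f x - aeval x p) - (cfc f y - aeval y p) * a := by
      rw [mul_sub, sub_mul, (h.aeval_right p).eq]; abel
    rw [e]
    calc _ ≤ ‖a * (cfc f x - aeval x p)‖ + ‖(cfc f y - aeval y p) * a‖ := norm_sub_le _ _
      _ ≤ ‖a‖ * ε + ε * ‖a‖ := by
        gcongr
        · exact (norm_mul_le _ _).trans (by gcongr)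
        · exact (norm_mul_le _ _).trans (by gcongr)
      _ = 2 * ‖a‖ * ε := by ring
  have lim : Tendsto (fun ε : ℝ => 2 * ‖a‖ * ε) (𝓝[>] 0) (𝓝 0) := by
    have : Tendsto (fun ε : ℝ => 2 * ‖a‖ * ε) (𝓝 0) (𝓝 (2 * ‖a‖ * 0)) :=
      (continuous_const.mul continuous_id).tendsto 0
    rw [mul_zero] at this
    exact this.mono_left nhdsWithin_le_nhds
  have h0 : ‖a * cfc f x - cfc f y * a‖ ≤ 0 :=
    ge_of_tendsto lim (eventually_mem_nhdsWithin.mono key)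
  exact sub_eq_zero.mp (norm_le_zero_iff.mp h0)

variable [PartialOrder 𝒜] [StarOrderedRing 𝒜]

theorem CFC.rpow_add_of_exponent_nonneg {a : 𝒜} {x y : ℝ} (hx : 0 ≤ x) (hy : 0 ≤ y) :
    a ^ (x + y) = a ^ x * a ^ y := by
  simp only [CFC.rpow_def]
  rw [← cfc_mul _ _ a (NNReal.continuous_rpow_const hx).continuousOn
    (NNReal.continuous_rpow_const hy).continuousOn]
  exact cfc_congr fun z _ => NNReal.rpow_add_of_nonneg z hx hy

theorem CFC.rpow_two_mul {a : 𝒜} {t : ℝ} (ht : 0 ≤ t) : a ^ (2 * t) = a ^ t * a ^ t := by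
  rw [two_mul, CFC.rpow_add_of_exponent_nonneg ht ht]

theorem CFC.abs_rpow_eq_cfc (a : 𝒜) {t : ℝ} (ht : 0 ≤ t) :
    CFC.abs a ^ t = cfc (fun x : ℝ => x ^ (1 / 2 * t)) (star a * a) := by
  have hnn : 0 ≤ star a * a := star_mul_self_nonneg a
  rw [CFC.abs, CFC.sqrt_eq_rpow, CFC.rpow_rpow_of_exponent_nonneg _ _ _ (by norm_num) ht,
    CFC.rpow_eq_cfc_real]

/-- `a |a|ᵗ = |a⋆|ᵗ a`. -/
theorem CFC.mul_abs_rpow (a : 𝒜) {t : ℝ} (ht : 0 ≤ t) :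
    a * CFC.abs a ^ t = CFC.abs (star a) ^ t * a := by
  rw [CFC.abs_rpow_eq_cfc a ht, CFC.abs_rpow_eq_cfc (star a) ht, star_star]
  refine SemiconjBy.cfc_real ?_ (.star_mul_self a) (.mul_star_self a)
    (Real.continuous_rpow_const (by positivity))
  simp [SemiconjBy, mul_assoc]

end Intertwining

section Hilbert

variable {H : Type*} [NormedAddCommGroup H] [InnerProductSpace ℂ H] [CompleteSpace H]

theorem IsSelfAdjoint.inner_apply_comm {T : H →L[ℂ] H} (hT : IsSelfAdjoint T) (x y : H) :
    inner ℂ (T x) y = inner ℂ x (T y) :=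
  hT.isSymmetric x y

theorem IsSelfAdjoint.norm_apply_sq {T : H →L[ℂ] H} (hT : IsSelfAdjoint T) (x : H) :
    ‖T x‖ ^ 2 = RCLike.re (inner ℂ ((T * T) x) x) := by
  rw [mul_apply_eq_comp, hT.inner_apply_comm, ← norm_sq_eq_re_inner (𝕜 := ℂ)]

theorem IsSelfAdjoint.norm_sq_add_norm_sq_le {P Q : H →L[ℂ] H} (hP : IsSelfAdjoint P)
    (hQ : IsSelfAdjoint Q) (z : H) :
    ‖P z‖ ^ 2 + ‖Q z‖ ^ 2 ≤ ‖P * P + Q * Q‖ * ‖z‖ ^ 2 := by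
  rw [hP.norm_apply_sq, hQ.norm_apply_sq, ← map_add, ← inner_add_left,
    ← add_apply]
  calc _ ≤ ‖(P * P + Q * Q) z‖ * ‖z‖ := re_inner_le_norm _ _
    _ ≤ ‖P * P + Q * Q‖ * ‖z‖ * ‖z‖ := by gcongr; exact ContinuousLinearMap.le_opNorm _ _
    _ = _ := by ring

/-- The row (P Q) is the adjoint of the column z ↦ (Pz, Qz), so it has the same norm. -/
theorem IsSelfAdjoint.norm_apply_add_apply_sq_le {P Q : H →L[ℂ] H} (hP : IsSelfAdjoint P)
    (hQ : IsSelfAdjoint Q) (u v : H) :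
    ‖P u + Q v‖ ^ 2 ≤ ‖P * P + Q * Q‖ * (‖u‖ ^ 2 + ‖v‖ ^ 2) := by
  set z := P u + Q v with hz
  set N := ‖P * P + Q * Q‖
  have h1 : ‖z‖ ^ 2 ≤ ‖u‖ * ‖P z‖ + ‖v‖ * ‖Q z‖ := by
    rw [norm_sq_eq_re_inner (𝕜 := ℂ)]
    nth_rewrite 1 [hz]
    rw [inner_add_left, map_add, hP.inner_apply_comm, hQ.inner_apply_comm]
    exact add_le_add (re_inner_le_norm _ _) (re_inner_le_norm _ _)
  have h2 := hP.norm_sq_add_norm_sq_le hQ z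
  have h3 : (‖u‖ * ‖P z‖ + ‖v‖ * ‖Q z‖) ^ 2
      ≤ (‖u‖ ^ 2 + ‖v‖ ^ 2) * (‖P z‖ ^ 2 + ‖Q z‖ ^ 2) := by
    nlinarith [sq_nonneg (‖u‖ * ‖Q z‖ - ‖v‖ * ‖P z‖)]
  have h4 : (‖z‖ ^ 2) ^ 2 ≤ (‖u‖ ^ 2 + ‖v‖ ^ 2) * (N * ‖z‖ ^ 2) :=
    (pow_le_pow_left₀ (by positivity) h1 2).trans (h3.trans (by gcongr))
  rcases (sq_nonneg ‖z‖).eq_or_lt with h0 | h0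
  · rw [← h0]; positivity
  · refine le_of_mul_le_mul_right ?_ h0
    linarith

theorem IsSelfAdjoint.four_mul_re_inner_le {P Q : H →L[ℂ] H} (hP : IsSelfAdjoint P)
    (hQ : IsSelfAdjoint Q) (u v : H) :
    4 * RCLike.re (inner ℂ (P u) (Q v)) ≤ ‖P * P + Q * Q‖ * (‖u‖ ^ 2 + ‖v‖ ^ 2) := by
  have h1 := norm_add_sq (𝕜 := ℂ) (P u) (Q v)
  have h2 := norm_sub_sq (𝕜 := ℂ) (P u) (Q v)
  have h3 := hP.norm_apply_add_apply_sq_le hQ u v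
  have h4 := sq_nonneg ‖P u - Q v‖
  linarith

/-- The arithmetic-geometric mean inequality `‖P Q‖ ≤ ‖P² + Q²‖ / 2` for self-adjoint operators,
in sesquilinear form. -/
theorem IsSelfAdjoint.norm_inner_apply_apply_le {P Q : H →L[ℂ] H} (hP : IsSelfAdjoint P)
    (hQ : IsSelfAdjoint Q) (u v : H) :
    ‖inner ℂ (P u) (Q v)‖ ≤ 1 / 2 * ‖P * P + Q * Q‖ * (‖u‖ * ‖v‖) := by
  rcases eq_or_ne u 0 with rfl | hu
  · simp
  rcases eq_or_ne v 0 with rfl | hv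
  · simp
  obtain ⟨c, hc, hcu⟩ : ∃ c : ℂ, ‖c‖ = 1 ∧
      ‖inner ℂ (P u) (Q v)‖ = RCLike.re (c * inner ℂ (P u) (Q v)) := by
    obtain ⟨c, hc, h⟩ := RCLike.exists_norm_eq_mul_self (inner ℂ (P u) (Q v) : ℂ)
    exact ⟨c, hc, by rw [← h, RCLike.ofReal_re]⟩
  have hu' : 0 < ‖u‖ := norm_pos_iff.mpr hu
  have hv' : 0 < ‖v‖ := norm_pos_iff.mpr hv
  -- Both rescaled vectors have norm ‖u‖‖v‖, and the phase c turns the real part into the modulus.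
  have h := hP.four_mul_re_inner_le hQ ((‖v‖ : ℂ) • u) ((c * ‖u‖) • v)
  have e : RCLike.re (inner ℂ (P ((‖v‖ : ℂ) • u)) (Q ((c * ‖u‖) • v)))
      = ‖u‖ * ‖v‖ * ‖inner ℂ (P u) (Q v)‖ := by
    rw [hcu, map_smul, map_smul, inner_smul_left, inner_smul_right, Complex.conj_ofReal,
      show (‖v‖ : ℂ) * (c * ‖u‖ * inner ℂ (P u) (Q v))
        = ((‖u‖ * ‖v‖ : ℝ) : ℂ) * (c * inner ℂ (P u) (Q v)) by push_cast; ring]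
    exact RCLike.re_ofReal_mul _ _
  rw [e, norm_smul, norm_smul, norm_mul, hc, Complex.norm_real, Complex.norm_real, norm_norm,
    norm_norm] at h
  refine le_of_mul_le_mul_left ?_ (mul_pos hu' hv')
  nlinarith

theorem CFC.isSelfAdjoint_abs_rpow (T : H →L[ℂ] H) (t : ℝ) : IsSelfAdjoint (CFC.abs T ^ t) :=
  .of_nonneg CFC.rpow_nonneg

theorem CFC.norm_abs_apply (T : H →L[ℂ] H) (x : H) : ‖CFC.abs T x‖ = ‖T x‖ := by
  have h : IsSelfAdjoint (CFC.abs T) := .of_nonneg (CFC.abs_nonneg T)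
  rw [← sq_eq_sq₀ (norm_nonneg _) (norm_nonneg _), h.norm_apply_sq, CFC.abs_mul_abs,
    norm_sq_eq_re_inner (𝕜 := ℂ), mul_apply_eq_comp,
    ContinuousLinearMap.star_eq_adjoint, ContinuousLinearMap.adjoint_inner_left]

theorem CFC.abs_rpow_mul_abs_rpow (T : H →L[ℂ] H) {s t : ℝ} (hs : 0 ≤ s) (ht : 0 ≤ t)
    (hst : s + t = 1) : CFC.abs T ^ s * CFC.abs T ^ t = CFC.abs T := by
  rw [← CFC.rpow_add_of_exponent_nonneg hs ht, hst, CFC.rpow_one _ (CFC.abs_nonneg T)]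

/-- A sequential substitute for the factorization `T = |T⋆|ᵗ U |T|¹⁻ᵗ` coming from the polar
decomposition: `T x` is a limit of `|T⋆|ᵗ wₙ` with `lim ‖wₙ‖ ≤ ‖|T|¹⁻ᵗ x‖`. -/
theorem CFC.exists_tendsto_abs_star_rpow_apply (T : H →L[ℂ] H) {t : ℝ} (h0 : 0 ≤ t) (h1 : t ≤ 1)
    (x : H) : ∃ (w : ℕ → H) (r : ℝ), r ≤ ‖(CFC.abs T ^ (1 - t)) x‖ ∧
      Tendsto (fun n => ‖w n‖) atTop (𝓝 r) ∧
      Tendsto (fun n => (CFC.abs (star T) ^ t) (w n)) atTop (𝓝 (T x)) := by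
  have h1' : 0 ≤ 1 - t := sub_nonneg.mpr h1
  set D := CFC.abs T ^ t with hD
  set C := CFC.abs T ^ (1 - t) with hC
  have hDsa : IsSelfAdjoint D := CFC.isSelfAdjoint_abs_rpow T t
  have hCsa : IsSelfAdjoint C := CFC.isSelfAdjoint_abs_rpow T (1 - t)
  have hCD : C * D = CFC.abs T := CFC.abs_rpow_mul_abs_rpow T h1' h0 (by ring)
  have hDC : D * C = CFC.abs T := CFC.abs_rpow_mul_abs_rpow T h0 h1' (by ring)
  -- Kᗮ = ker D, on which T vanishes, so x can be replaced by its projection x₀, a limit of vectors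
  -- D zₙ. The witnesses are wₙ = T zₙ.
  set K : Submodule ℂ H := D.range.topologicalClosure with hK
  set x₀ : H := K.starProjection x with hx₀
  set x₁ : H := x - x₀ with hx₁
  have hx₀K : x₀ ∈ K := K.starProjection_apply_mem x
  have hx₁K : x₁ ∈ Kᗮ := K.sub_starProjection_mem_orthogonal x
  have hDx₁ : D x₁ = 0 := by
    have : x₁ ∈ D.rangeᗮ := by rwa [hK, Submodule.orthogonal_closure] at hx₁K
    rwa [ContinuousLinearMap.orthogonal_range, hDsa.adjoint_eq] at this
  have hTx₁ : T x₁ = 0 := by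
    rw [← norm_eq_zero, ← CFC.norm_abs_apply, ← hCD, mul_apply_eq_comp, hDx₁,
      map_zero, norm_zero]
  have hTx : T x₀ = T x := by
    have : T x - T x₀ = 0 := by rw [← map_sub]; exact hTx₁
    exact (sub_eq_zero.mp this).symm
  -- C commutes with D, so C² preserves ker D. This also covers t = 1, where C = 1 need not kill x₁.
  have horth : inner ℂ (C x₀) (C x₁) = 0 := by
    rw [hCsa.inner_apply_comm]
    have : C (C x₁) ∈ Kᗮ := by
      rw [hK, Submodule.orthogonal_closure, ContinuousLinearMap.orthogonal_range,
        hDsa.adjoint_eq]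
      change D (C (C x₁)) = 0
      calc D (C (C x₁)) = (D * C) (C x₁) := rfl
        _ = C (D (C x₁)) := by rw [hDC, ← hCD]; rfl
        _ = C ((D * C) x₁) := rfl
        _ = C (C (D x₁)) := by rw [hDC, ← hCD]; rfl
        _ = 0 := by rw [hDx₁, map_zero, map_zero]
    exact this x₀ hx₀K
  have hnorm : ‖C x₀‖ ≤ ‖C x‖ := by
    have hsum : C x = C x₀ + C x₁ := by rw [← map_add, hx₁, add_sub_cancel]
    have hpy := norm_add_sq_eq_norm_sq_add_norm_sq_of_inner_eq_zero (C x₀) (C x₁) horth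
    rw [hsum]
    refine le_of_sq_le_sq ?_ (norm_nonneg _)
    nlinarith [mul_self_nonneg ‖C x₁‖]
  obtain ⟨y, hy, hyx⟩ := mem_closure_iff_seq_limit.mp
    (show x₀ ∈ closure (D.range : Set H) from hx₀K)
  choose z hz using hy
  have hz' : ∀ n, D (z n) = y n := hz
  refine ⟨fun n => T (z n), ‖C x₀‖, hnorm, ?_, ?_⟩
  · have e : ∀ n, ‖T (z n)‖ = ‖C (y n)‖ := fun n => by
      rw [← CFC.norm_abs_apply, ← hCD, mul_apply_eq_comp, hz']
    simp only [e]
    exact ((C.continuous.tendsto x₀).comp hyx).norm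
  · have e : ∀ n, (CFC.abs (star T) ^ t) (T (z n)) = T (y n) := fun n => by
      rw [← hz', ← mul_apply_eq_comp, ← mul_apply_eq_comp, hD,
        CFC.mul_abs_rpow T h0]
    simp only [e, ← hTx]
    exact (T.continuous.tendsto x₀).comp hyx

theorem norm_inner_mul_apply_le (A B : H →L[ℂ] H) {t : ℝ} (h0 : 0 ≤ t) (h1 : t ≤ 1) (x : H) :
    ‖inner ℂ ((A * B) x) x‖ ≤ 1 / 4 *
      (‖CFC.abs A ^ (2 * t) + CFC.abs (star B) ^ (2 * t)‖ *
        ‖CFC.abs (star A) ^ (2 * (1 - t)) + CFC.abs B ^ (2 * (1 - t))‖) * ‖x‖ ^ 2 := by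
  have h1' : 0 ≤ 1 - t := sub_nonneg.mpr h1
  simp only [CFC.rpow_two_mul h0, CFC.rpow_two_mul h1']
  obtain ⟨v, r, hr, hvr, hv⟩ := CFC.exists_tendsto_abs_star_rpow_apply B h0 h1 x
  -- Applied to A⋆, so that the outer factor is a power of |A|.
  obtain ⟨u, s, hs, hus, hu⟩ := CFC.exists_tendsto_abs_star_rpow_apply (star A) h0 h1 x
  rw [star_star] at hu
  set P := CFC.abs A ^ t
  set Q := CFC.abs (star B) ^ t
  set C := CFC.abs (star A) ^ (1 - t)
  set D := CFC.abs B ^ (1 - t)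
  have hP : IsSelfAdjoint P := CFC.isSelfAdjoint_abs_rpow A t
  have hQ : IsSelfAdjoint Q := CFC.isSelfAdjoint_abs_rpow (star B) t
  have hr0 : 0 ≤ r := ge_of_tendsto' hvr fun n => norm_nonneg _
  have hs0 : 0 ≤ s := ge_of_tendsto' hus fun n => norm_nonneg _
  have hlim : ‖inner ℂ (star A x) (B x)‖ ≤ 1 / 2 * ‖P * P + Q * Q‖ * (s * r) :=
    le_of_tendsto_of_tendsto' (hu.inner hv).norm ((hus.mul hvr).const_mul _)
      fun n => hP.norm_inner_apply_apply_le hQ (u n) (v n)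
  have hCD := (CFC.isSelfAdjoint_abs_rpow (star A) (1 - t)).norm_sq_add_norm_sq_le
    (CFC.isSelfAdjoint_abs_rpow B (1 - t)) x
  have hsr : s * r ≤ 1 / 2 * (‖C * C + D * D‖ * ‖x‖ ^ 2) := by
    have : s * r ≤ ‖C x‖ * ‖D x‖ := mul_le_mul hs hr hr0 (norm_nonneg _)
    nlinarith [sq_nonneg (‖C x‖ - ‖D x‖)]
  have e : ‖inner ℂ ((A * B) x) x‖ = ‖inner ℂ (star A x) (B x)‖ := by
    rw [mul_apply_eq_comp, norm_inner_symm,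
      ContinuousLinearMap.star_eq_adjoint, ContinuousLinearMap.adjoint_inner_left]
  rw [e]
  calc _ ≤ 1 / 2 * ‖P * P + Q * Q‖ * (s * r) := hlim
    _ ≤ 1 / 2 * ‖P * P + Q * Q‖ * (1 / 2 * (‖C * C + D * D‖ * ‖x‖ ^ 2)) := by gcongr
    _ = _ := by ring

theorem norm_inner_mul_apply_le_iInf (A B : H →L[ℂ] H) {x : H} (hx : ‖x‖ = 1) :
    ‖inner ℂ ((A * B) x) x‖ ≤ 1 / 4 * ⨅ t : Set.Icc (0 : ℝ) 1,
      ‖CFC.abs A ^ (2 * (t : ℝ)) + CFC.abs (star B) ^ (2 * (t : ℝ))‖ *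
        ‖CFC.abs (star A) ^ (2 * (1 - (t : ℝ))) + CFC.abs B ^ (2 * (1 - (t : ℝ)))‖ := by
  rw [Real.mul_iInf_of_nonneg (by norm_num)]
  refine le_ciInf fun t => ?_
  simpa [hx] using norm_inner_mul_apply_le A B t.2.1 t.2.2 x

end Hilbert


/- `CFC.abs T` is `|T| = (T⋆ T)^(1/2)`, and the powers are those of the continuous functional
calculus, so `|T| ^ 0 = 1`. Each infimum is over a nonempty set of nonnegative reals. -/
theorem corollary2p16 {H : Type*} [NormedAddCommGroup H] [InnerProductSpace ℂ H] [CompleteSpace H]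
    (A B : H →L[ℂ] H) :
    numericalRadius (A * B + B * A) ≤ (1 / 4 : ℝ) *
      ((⨅ t : Set.Icc (0 : ℝ) 1,
          ‖CFC.abs A ^ (2 * (t : ℝ)) + CFC.abs (star B) ^ (2 * (t : ℝ))‖ *
          ‖CFC.abs (star A) ^ (2 * (1 - (t : ℝ))) + CFC.abs B ^ (2 * (1 - (t : ℝ)))‖) +
        (⨅ t : Set.Icc (0 : ℝ) 1,
          ‖CFC.abs B ^ (2 * (t : ℝ)) + CFC.abs (star A) ^ (2 * (t : ℝ))‖ *
          ‖CFC.abs (star B) ^ (2 * (1 - (t : ℝ))) + CFC.abs A ^ (2 * (1 - (t : ℝ)))‖)) ∧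
    numericalRadius (A * B - B * A) ≤ (1 / 4 : ℝ) *
      ((⨅ t : Set.Icc (0 : ℝ) 1,
          ‖CFC.abs A ^ (2 * (t : ℝ)) + CFC.abs (star B) ^ (2 * (t : ℝ))‖ *
          ‖CFC.abs (star A) ^ (2 * (1 - (t : ℝ))) + CFC.abs B ^ (2 * (1 - (t : ℝ)))‖) +
        (⨅ t : Set.Icc (0 : ℝ) 1,
          ‖CFC.abs B ^ (2 * (t : ℝ)) + CFC.abs (star A) ^ (2 * (t : ℝ))‖ *
          ‖CFC.abs (star B) ^ (2 * (1 - (t : ℝ))) + CFC.abs A ^ (2 * (1 - (t : ℝ)))‖)) := by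
  have key : ∀ S : H →L[ℂ] H, (∀ x : H, ‖inner ℂ (S x) x‖ ≤
      ‖inner ℂ ((A * B) x) x‖ + ‖inner ℂ ((B * A) x) x‖) → ∀ c : ℝ, 0 ≤ c →
      (∀ x : H, ‖x‖ = 1 → ‖inner ℂ ((A * B) x) x‖ + ‖inner ℂ ((B * A) x) x‖ ≤ c) →
      numericalRadius S ≤ c := by
    intro S hS c hc hle
    refine Real.sSup_le ?_ hc
    rintro _ ⟨x, hx, rfl⟩
    exact (hS x).trans (hle x hx)
  have hle := fun (x : H) (hx : ‖x‖ = 1) =>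
    (add_le_add (norm_inner_mul_apply_le_iInf A B hx)
      (norm_inner_mul_apply_le_iInf B A hx)).trans_eq (mul_add _ _ _).symm
  -- Nonnegativity is needed for the zero space, where the supremum is over the empty set.
  have hc := mul_nonneg (by norm_num : (0 : ℝ) ≤ 1 / 4) (add_nonneg
    (Real.iInf_nonneg fun t : Set.Icc (0 : ℝ) 1 => mul_nonneg
      (norm_nonneg (CFC.abs A ^ (2 * (t : ℝ)) + CFC.abs (star B) ^ (2 * (t : ℝ))))
      (norm_nonneg (CFC.abs (star A) ^ (2 * (1 - (t : ℝ))) + CFC.abs B ^ (2 * (1 - (t : ℝ))))))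
    (Real.iInf_nonneg fun t : Set.Icc (0 : ℝ) 1 => mul_nonneg
      (norm_nonneg (CFC.abs B ^ (2 * (t : ℝ)) + CFC.abs (star A) ^ (2 * (t : ℝ))))
      (norm_nonneg (CFC.abs (star B) ^ (2 * (1 - (t : ℝ))) + CFC.abs A ^ (2 * (1 - (t : ℝ)))))))
  refine ⟨key _ (fun x => ?_) _ hc hle, key _ (fun x => ?_) _ hc hle⟩
  · rw [add_apply, inner_add_left]
    exact norm_add_le _ _
  · rw [sub_apply, inner_sub_left]
    exact norm_sub_le _ _
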